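/- Let $(G,+)$ be a finite abelian group, and let $p(G)$ denote the smallest cardinality of a non-zero subgroup of $G$ ($p(G)=\infty$ if $G$ is trivial). Let $M$ and $N$ be matroids whose ground sets $E(M)$ and $E(N)$ are subsets of $G$, both of rank $n$, with $|E(M)|=|E(N)|=n+1<p(G)$ and $0\notin E(N)$. Assume that $|(-a+E(M))\cap E(N)|\neq n$ for every $a\in E(M)$. Assume further that $E(M)$ is not a progression, i.e. not of the form $\{a,a+x,\dots,a+(k-1)x\}$ with $a,x\in G$ and an integer $k\ge 1$, and that $E(M)$ is not a semi-progression, i.e. there is no $a\in E(M)$ such that $E(M)\setminus\{a\}$ is a progression. Then $M$ is matched to $N$: for every basis $\mathcal M$ of $M$ there are a basis $\mathcal N$ of $N$ and a bijection $f:\mathcal M\to\mathcal N$ such that $a+f(a)\notin E(M)$ for every $a\in\mathcal M$. -/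

import Mathlib

open scoped Pointwise

/-- The smallest cardinality of a non-zero subgroup of `G`, written `p(G)`
(equal to `⊤` for the trivial group, which has no non-zero subgroup). -/
noncomputable def minSubgroupCard (G : Type*) [AddCommGroup G] : ℕ∞ :=
  ⨅ (H : AddSubgroup G) (_ : H ≠ ⊥), ENat.card H

/-- `A` is a progression `{a, a + x, …, a + (k - 1) x}` for some `a, x` and some `k ≥ 1`. -/
def IsProgression {G : Type*} [AddCommGroup G] (A : Set G) : Prop :=
  ∃ (a x : G) (k : ℕ), 0 < k ∧ A = {g | ∃ i : ℕ, i < k ∧ g = a + i • x}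

/-- `A` is a semi-progression: removing one of its elements leaves a progression. -/
def IsSemiProgression {G : Type*} [AddCommGroup G] (A : Set G) : Prop :=
  ∃ a ∈ A, IsProgression (A \ {a})

/-- The basis `A` of the matroid `M` is matched to the set `B`: the elements of `A` and `B`
can be paired off bijectively so that the sum of each pair lies outside the ground set of `M`. -/
def BasisMatched {G : Type*} [AddCommGroup G] (M : Matroid G) (A B : Set G) : Prop :=
  ∃ f : A ≃ B, ∀ a : A, (a : G) + (f a : G) ∉ M.E

/-- `M` is matched to `N`: every basis of `M` is matched to some basis of `N`. -/
def MatroidMatched {G : Type*} [AddCommGroup G] (M N : Matroid G) : Prop :=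
  ∀ A : Set G, M.IsBase A → ∃ B : Set G, N.IsBase B ∧ BasisMatched M A B

/-!
Given a basis `A` of `M`, any basis `B` of `N` will do: Hall's theorem provides the bijection
(`exists_injective_add_notMem`). If Hall's condition fails, there are `S ⊆ A` and `T ⊆ B` with
`#S + #T > n` and `S + T ⊆ E(M)`. As `0 ∉ B`, the set `T₀ = T ∪ {0}` has `#T + 1` elements and still
satisfies `S + T₀ ⊆ E(M)`, so the Cauchy–Davenport inequality forces `S + T₀ = E(M)` and
`#(S + T₀) = #S + #T₀ - 1`.

* If `S = {a}`, then `T = B` and `a + B ⊆ E(M)`. The set `(-a + E(M)) ∩ E(N)` contains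
  `B` and does not have `n` elements, so it is all of `-a + E(M)`. Hence `0 ∈ E(N)`: a contradiction.
* If `#S ≥ 2`, the sumset `E(M)` is a progression by the following weak form of Vosper's theorem
  (`isProgression_add_of_card_add_lt`): two sets with at least two elements each, whose sumset has
  fewer elements than every non-zero subgroup and attains equality in the Cauchy–Davenport
  inequality, have a progression as sumset.

The weak form is easier than Vosper's theorem, which describes the summands: a Dyson
`e`-transform that shrinks `B` keeps the sumset unchanged in the equality case, so induction on `#B`
reduces the claim to `#B = 2`, provided that some `e`-transform leaves `B` with at least two
elements but not with all of them (`exists_one_lt_card_addDysonETransform_lt`). In the case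
`B = {0, t}`, exactly one element of `A` leaves `A` when `t` is added.
-/

open Finset

/-! ### Cauchy–Davenport for small sumsets -/

theorem minSubgroupCard_le_minOrder (G : Type*) [AddCommGroup G] :
    minSubgroupCard G ≤ AddMonoid.minOrder G := by
  rw [AddMonoid.le_minOrder_iff_forall_addSubgroup]
  intro H hH hfin
  have : Finite H := hfin
  exact (iInf₂_le H hH).trans_eq (ENat.card_eq_coe_natCard H)

section Additive

variable {G : Type*} [AddCommGroup G] [DecidableEq G]

/-- The Cauchy–Davenport inequality without a minimum and without truncated subtraction, for a
sumset inside a set smaller than every non-zero subgroup. -/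
theorem card_add_card_le_of_add_subset {S T U : Finset G} (hS : S.Nonempty) (hT : T.Nonempty)
    (hU : S + T ⊆ U) (hp : (#U : ℕ∞) < AddMonoid.minOrder G) : #S + #T ≤ #U + 1 := by
  have h := cauchy_davenport_minOrder_add hS hT
  have hle : (#(S + T) : ℕ∞) ≤ #U := by exact_mod_cast card_le_card hU
  rcases min_le_iff.1 h with h | h
  · exact absurd (h.trans hle) hp.not_ge
  · have h' : #S + #T - 1 ≤ #U := by exact_mod_cast h.trans hle
    omega

/-- The Cauchy–Davenport inequality fails for the sumset `R + {0, t} = R` if `t ≠ 0`. -/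
theorem eq_zero_of_forall_add_mem {R : Finset G} {t : G} (hR : R.Nonempty)
    (hp : (#R : ℕ∞) < AddMonoid.minOrder G) (h : ∀ r ∈ R, r + t ∈ R) : t = 0 := by
  by_contra ht
  have hsub : R + {0, t} ⊆ R := by
    intro x hx
    obtain ⟨r, hr, s, hs, rfl⟩ := mem_add.1 hx
    rcases mem_insert.1 hs with rfl | hs
    · simpa using hr
    · rw [mem_singleton.1 hs]
      exact h r hr
  have := card_add_card_le_of_add_subset hR (insert_nonempty _ _) hsub hp
  rw [card_pair (Ne.symm ht)] at this
  omega

theorem exists_add_nsmul_notMem {A : Finset G} {t : G} (ht : t ≠ 0)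
    (hp : (#A : ℕ∞) < AddMonoid.minOrder G) (a : G) : ∃ i : ℕ, a + i • t ∉ A := by
  by_contra! h
  -- The elements of `A` whose whole forward orbit stays in `A` form a set stable under `+ t`.
  classical
  let R := A.filter fun x ↦ ∀ i : ℕ, x + i • t ∈ A
  have haR : a ∈ R := mem_filter.2 ⟨by simpa using h 0, h⟩
  refine ht (eq_zero_of_forall_add_mem ⟨a, haR⟩ (lt_of_le_of_lt ?_ hp) fun r hr ↦ ?_)
  · exact_mod_cast card_le_card (filter_subset _ _)
  · have hr' := (mem_filter.1 hr).2
    refine mem_filter.2 ⟨by simpa using hr' 1, fun i ↦ ?_⟩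
    have := hr' (i + 1)
    rwa [succ_nsmul', ← add_assoc] at this

/-! ### A weak form of Vosper's theorem -/

/-- The two-element case of Vosper's theorem. All elements of `A` lie on one chain
`y, y - t, y - 2t, …`, where `y` is the only element of `A` with `y + t ∉ A`. -/
theorem isProgression_add_pair {A : Finset G} {t : G} (hA : A.Nonempty) (ht : t ≠ 0)
    (hcard : #(A + {0, t}) < #A + 2) (hp : (#(A + {0, t}) : ℕ∞) < AddMonoid.minOrder G) :
    IsProgression (↑(A + {0, t}) : Set G) := by
  have hmem : ∀ g, g ∈ A + {0, t} ↔ g ∈ A ∨ ∃ a ∈ A, a + t = g := by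
    intro g
    simp [mem_add, and_or_left, exists_or]
  have hsub : A ⊆ A + {0, t} := fun a ha ↦ (hmem a).2 (Or.inl ha)
  have hpA : (#A : ℕ∞) < AddMonoid.minOrder G :=
    lt_of_le_of_lt (by exact_mod_cast card_le_card hsub) hp
  -- Every element of `A` is followed, along `t`, by a last element inside `A`.
  have hlast : ∀ a ∈ A, ∃ j : ℕ, a + j • t ∈ A ∧ a + j • t + t ∉ A ∧ ∀ i ≤ j, a + i • t ∈ A := by
    classical
    intro a ha
    have hex := exists_add_nsmul_notMem ht hpA a
    have hne : Nat.find hex ≠ 0 := by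
      intro h0
      have := Nat.find_spec hex
      rw [h0] at this
      simp [ha] at this
    obtain ⟨j, hj⟩ := Nat.exists_eq_succ_of_ne_zero hne
    have hlt : ∀ i ≤ j, a + i • t ∈ A := fun i hi ↦
      not_not.1 (Nat.find_min hex (by omega))
    refine ⟨j, hlt j le_rfl, ?_, hlt⟩
    have := Nat.find_spec hex
    rwa [hj, Nat.succ_eq_add_one, succ_nsmul, ← add_assoc] at this
  obtain ⟨a₀, ha₀⟩ := hA
  obtain ⟨j₀, hy, hyt, -⟩ := hlast a₀ ha₀
  generalize a₀ + j₀ • t = y at hy hyt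
  -- As the sumset has only one element outside `A`, this last element is always the same.
  have huniq : ∀ x ∈ A, x + t ∉ A → x = y := by
    intro x hx hxt
    have hle : #((A + {0, t}) \ A) ≤ 1 := by
      rw [card_sdiff_of_subset hsub]
      omega
    have := card_le_one.1 hle (x + t) (mem_sdiff.2 ⟨(hmem _).2 (Or.inr ⟨x, hx, rfl⟩), hxt⟩)
      (y + t) (mem_sdiff.2 ⟨(hmem _).2 (Or.inr ⟨y, hy, rfl⟩), hyt⟩)
    exact add_right_cancel this
  classical
  have hex := exists_add_nsmul_notMem (neg_ne_zero.2 ht) hpA y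
  have hchain : ∀ g, g ∈ A ↔ ∃ i < Nat.find hex, g = y + i • (-t) := by
    intro g
    constructor
    · intro hg
      obtain ⟨j, hj, hjt, hall⟩ := hlast g hg
      have hgy := huniq _ hj hjt
      refine ⟨j, ?_, by rw [← hgy]; simp⟩
      rw [Nat.lt_find_iff]
      intro m hm
      have := hall (j - m) (by omega)
      have hjm : j • t = (j - m) • t + m • t := by rw [← add_nsmul]; congr 1; omega
      rw [not_not, ← hgy, hjm]
      simpa [add_assoc] using this
    · rintro ⟨i, hi, rfl⟩
      exact not_not.1 (Nat.find_min hex hi)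
  refine ⟨y + t, -t, Nat.find hex + 1, Nat.succ_pos _, Set.ext fun g ↦ ?_⟩
  rw [mem_coe, hmem, Set.mem_ofPred_eq]
  constructor
  · rintro (hg | ⟨a, ha, rfl⟩)
    · obtain ⟨i, hi, rfl⟩ := (hchain g).1 hg
      exact ⟨i + 1, by omega, by rw [succ_nsmul]; abel⟩
    · obtain ⟨i, hi, rfl⟩ := (hchain a).1 ha
      exact ⟨i, by omega, by abel⟩
  · rintro ⟨i, hi, rfl⟩
    rcases i with _ | i
    · exact Or.inr ⟨y, hy, by simp⟩
    · exact Or.inl ((hchain _).2 ⟨i, by omega, by rw [succ_nsmul]; abel⟩)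

/-- Otherwise `A` splits into `X = {e | e + B ⊆ A}` and `Y = {e | (e + B) ∩ A = {e}}`. Applying the
Cauchy–Davenport inequality to `Y + (B \ {0}) ⊆ (A + B) \ A` gives `#Y ≤ 1`, and applying it to
`X + B ⊆ A` then gives `#B ≤ 2`. -/
theorem exists_one_lt_card_addDysonETransform_lt {A B : Finset G} (hA : 2 ≤ #A) (hB : 3 ≤ #B)
    (h0 : 0 ∈ B) (hcard : #(A + B) < #A + #B) (hp : (#(A + B) : ℕ∞) < AddMonoid.minOrder G) :
    ∃ e ∈ A, 1 < #(addDysonETransform e (A, B)).2 ∧ #(addDysonETransform e (A, B)).2 < #B := by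
  by_contra! hcon
  have hsub : A ⊆ A + B := fun a ha ↦ mem_add.2 ⟨a, ha, 0, h0, add_zero a⟩
  have hpA : (#A : ℕ∞) < AddMonoid.minOrder G :=
    lt_of_le_of_lt (by exact_mod_cast card_le_card hsub) hp
  have hmem : ∀ e b, b ∈ (addDysonETransform e (A, B)).2 ↔ b ∈ B ∧ e + b ∈ A := by
    intro e b
    simp [addDysonETransform, mem_neg_vadd_finset_iff]
  classical
  let X := A.filter fun e ↦ ∀ b ∈ B, e + b ∈ A
  let Y := A.filter fun e ↦ ¬ ∀ b ∈ B, e + b ∈ A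
  have hXY : #X + #Y = #A := card_filter_add_card_filter_not _
  have hY : ∀ e ∈ Y, ∀ b ∈ B, b ≠ 0 → e + b ∉ A := by
    intro e he b hb hb0 hmemA
    obtain ⟨heA, hne⟩ := mem_filter.1 he
    have hle := hcon e heA (one_lt_card.2
      ⟨b, (hmem e b).2 ⟨hb, hmemA⟩, 0, (hmem e 0).2 ⟨h0, by simpa using heA⟩, hb0⟩)
    have heq := eq_of_subset_of_card_le (fun b hb ↦ ((hmem e b).1 hb).1) hle
    exact hne fun b hb ↦ ((hmem e b).1 (heq.symm.subset hb)).2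
  have hY1 : #Y ≤ 1 := by
    rcases Y.eq_empty_or_nonempty with hYe | hYn
    · simp [hYe]
    have hYsub : Y + B.erase 0 ⊆ (A + B) \ A := by
      intro g hg
      obtain ⟨e, he, b, hb, rfl⟩ := mem_add.1 hg
      obtain ⟨hb0, hb⟩ := mem_erase.1 hb
      exact mem_sdiff.2 ⟨add_mem_add (mem_filter.1 he).1 hb, hY e he b hb hb0⟩
    have hc := card_erase_of_mem h0
    have hd := card_sdiff_of_subset hsub
    have := card_add_card_le_of_add_subset hYn (card_pos.1 (by omega)) hYsub
      (lt_of_le_of_lt (by exact_mod_cast card_le_card sdiff_subset) hp)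
    omega
  have hXsub : X + B ⊆ A := by
    intro g hg
    obtain ⟨e, he, b, hb, rfl⟩ := mem_add.1 hg
    exact (mem_filter.1 he).2 b hb
  have := card_add_card_le_of_add_subset (card_pos.1 (by omega)) ⟨0, h0⟩ hXsub hpA
  omega

/-- A weak form of Vosper's theorem, describing only the sumset. The condition `0 ∈ B` is a
normalisation: translating `B` translates the sumset. -/
theorem isProgression_add_of_card_add_lt {A B : Finset G} (hA : 2 ≤ #A) (hB : 2 ≤ #B)
    (h0 : 0 ∈ B) (hcard : #(A + B) < #A + #B) (hp : (#(A + B) : ℕ∞) < AddMonoid.minOrder G) :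
    IsProgression (↑(A + B) : Set G) := by
  induction hk : #B using Nat.strong_induction_on generalizing A B with
  | _ k ih =>
    rcases hB.eq_or_lt with hB2 | hB3
    · obtain ⟨t, ht⟩ := card_eq_one.1 (show #(B.erase 0) = 1 by rw [card_erase_of_mem h0]; omega)
      have hBt : B = {0, t} := by rw [← insert_erase h0, ht]
      have ht0 : t ≠ 0 := (mem_erase.1 (ht ▸ mem_singleton_self t)).1
      subst hBt
      exact isProgression_add_pair (card_pos.1 (by omega)) ht0 (by omega) hp
    · obtain ⟨e, he, h1, h2⟩ := exists_one_lt_card_addDysonETransform_lt hA hB3 h0 hcard hp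
      have hsub := addDysonETransform.subset e (A, B)
      have hsum := addDysonETransform.card e (A, B)
      have hAsub : A ⊆ (addDysonETransform e (A, B)).1 := subset_union_left
      have h0' : 0 ∈ (addDysonETransform e (A, B)).2 := by
        simp [addDysonETransform, mem_neg_vadd_finset_iff, h0, he]
      generalize addDysonETransform e (A, B) = P at *
      have hA' := card_le_card hAsub
      dsimp only at hsub hsum
      have hCD := card_add_card_le_of_add_subset (S := P.1) (T := P.2)
        (card_pos.1 (by omega)) ⟨0, h0'⟩ hsub hp
      -- Cauchy–Davenport for the transformed pair shows that its sumset is still all of `A + B`.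
      have hCD' := card_add_card_le_of_add_subset (S := P.1) (T := P.2)
        (card_pos.1 (by omega)) ⟨0, h0'⟩ subset_rfl
        (lt_of_le_of_lt (by exact_mod_cast card_le_card hsub) hp)
      have heq : P.1 + P.2 = A + B := eq_of_subset_of_card_le hsub (by omega)
      rw [← heq]
      refine ih #P.2 (by omega) (by omega) (by omega) h0' ?_ ?_ rfl
      · rw [heq]; omega
      · rw [heq]; exact hp

/-! ### Matchings from Hall's theorem -/

/-- The hypothesis `hsingle` is Hall's condition for the one-element subsets of `A`. The weak form
of Vosper's theorem gives the condition for the larger ones. -/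
theorem exists_injective_add_notMem {E A B : Finset G} (hAE : A ⊆ E) (hE : #E = #A + 1)
    (hAB : #A = #B) (h0 : 0 ∉ B) (hp : (#E : ℕ∞) < AddMonoid.minOrder G)
    (hprog : ¬ IsProgression (E : Set G)) (hsingle : ∀ a ∈ A, ∃ b ∈ B, a + b ∉ E) :
    ∃ f : A → G, Function.Injective f ∧ ∀ a : A, f a ∈ B ∧ (a : G) + f a ∉ E := by
  have hall := (all_card_le_biUnion_card_iff_exists_injective
    fun a : A ↦ B.filter fun b ↦ (a : G) + b ∉ E).1 ?_
  · obtain ⟨f, hf, hmem⟩ := hall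
    exact ⟨f, hf, fun a ↦ mem_filter.1 (hmem a)⟩
  intro s
  by_contra! hlt
  set U := s.biUnion fun a : A ↦ B.filter fun b ↦ (a : G) + b ∉ E with hU
  let S : Finset G := s.map (Function.Embedding.subtype _)
  have hScard : #S = #s := card_map _
  have hSA : S ⊆ A := by
    intro g hg
    obtain ⟨a, -, rfl⟩ := mem_map.1 hg
    exact a.2
  have hSA' := card_le_card hSA
  have hUB : U ⊆ B := biUnion_subset.2 fun _ _ ↦ filter_subset _ _
  have hT := card_sdiff_of_subset hUB
  have hUB' := card_le_card hUB
  have hT0 : #(insert 0 (B \ U)) = #(B \ U) + 1 :=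
    card_insert_of_notMem fun h ↦ h0 (mem_sdiff.1 h).1
  have hadd : ∀ g ∈ S, ∀ b ∈ B \ U, g + b ∈ E := by
    intro g hg b hb
    obtain ⟨a, ha, rfl⟩ := mem_map.1 hg
    by_contra hne
    exact (mem_sdiff.1 hb).2 (mem_biUnion.2 ⟨a, ha, mem_filter.2 ⟨(mem_sdiff.1 hb).1, hne⟩⟩)
  have hsub : S + insert 0 (B \ U) ⊆ E := by
    intro g hg
    obtain ⟨a, ha, b, hb, rfl⟩ := mem_add.1 hg
    rcases mem_insert.1 hb with rfl | hb
    · simpa using hAE (hSA ha)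
    · exact hadd a ha b hb
  have hSn : S.Nonempty := card_pos.1 (by omega)
  have hp' : (#(S + insert 0 (B \ U)) : ℕ∞) < AddMonoid.minOrder G :=
    lt_of_le_of_lt (by exact_mod_cast card_le_card hsub) hp
  have hsub' := card_le_card hsub
  have hCD := card_add_card_le_of_add_subset hSn (insert_nonempty _ _) subset_rfl hp'
  have heq : S + insert 0 (B \ U) = E := eq_of_subset_of_card_le hsub (by omega)
  rcases Nat.lt_or_ge #S 2 with hS | hS
  · obtain ⟨a, ha⟩ := hSn
    obtain ⟨b, hb, hne⟩ := hsingle a (hSA ha)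
    have hTB : B \ U = B := eq_of_subset_of_card_le sdiff_subset (by omega)
    exact hne (hadd a ha b (hTB.symm ▸ hb))
  · refine hprog ?_
    rw [← heq]
    exact isProgression_add_of_card_add_lt hS (by omega) (mem_insert_self _ _) (by omega) hp'

end Additive

/-! ### Matched matroids -/

theorem mainTheorem3 {G : Type*} [AddCommGroup G] [Finite G] (M N : Matroid G) (n : ℕ)
    (hMrank : M.eRank = n) (hNrank : N.eRank = n)
    (hMcard : M.E.encard = n + 1) (hNcard : N.E.encard = n + 1)
    (hp : (n : ℕ∞) + 1 < minSubgroupCard G)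
    (hinter : ∀ a ∈ M.E, ((-a +ᵥ M.E) ∩ N.E).encard ≠ n)
    (hprog : ¬ IsProgression M.E) (hsemi : ¬ IsSemiProgression M.E)
    (hzero : (0 : G) ∉ N.E) :
    MatroidMatched M N := by
  classical
  intro A hA
  obtain ⟨B, hB⟩ := N.exists_isBase
  refine ⟨B, hB, ?_⟩
  have hAn : A.encard = n := hA.encard_eq_eRank.trans hMrank
  have hBn : B.encard = n := hB.encard_eq_eRank.trans hNrank
  have hAE := hA.subset_ground
  have hBE := hB.subset_ground
  have hEset : ∃ E : Finset G, (E : Set G) = M.E := (M.E.toFinite).exists_finset_coe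
  obtain ⟨E, hE⟩ := hEset
  obtain ⟨A, rfl⟩ := A.toFinite.exists_finset_coe
  obtain ⟨B, rfl⟩ := B.toFinite.exists_finset_coe
  rw [Set.encard_coe_eq_coe_finsetCard, Nat.cast_inj] at hAn hBn
  have hEn : #E = n + 1 := by
    rw [← hE, Set.encard_coe_eq_coe_finsetCard] at hMcard
    exact_mod_cast hMcard
  have hsingle : ∀ a ∈ A, ∃ b ∈ B, a + b ∉ E := by
    intro a ha
    by_contra! h
    have haE : a ∈ M.E := hAE ha
    have hBsub : (B : Set G) ⊆ (-a +ᵥ M.E) ∩ N.E := by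
      intro b hb
      refine ⟨Set.mem_neg_vadd_set_iff.2 ?_, hBE hb⟩
      rw [← hE]
      exact h b hb
    -- The intersection has at least `n` elements, hence `n + 1`, and so it is all of `-a + E(M)`.
    have hle := Set.encard_le_encard hBsub
    rw [Set.encard_coe_eq_coe_finsetCard, hBn] at hle
    have hge := Order.add_one_le_of_lt (lt_of_le_of_ne hle (hinter a haE).symm)
    have hEq : (-a +ᵥ M.E) ∩ N.E = -a +ᵥ M.E :=
      (Set.toFinite _).eq_of_subset_of_encard_le Set.inter_subset_left
        (by rw [Set.encard_vadd_set, hMcard]; exact hge)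
    have h0 : (0 : G) ∈ (-a +ᵥ M.E) ∩ N.E := by
      rw [hEq]
      exact Set.mem_neg_vadd_set_iff.2 (by simpa using haE)
    exact hzero h0.2
  obtain ⟨f, hf, hfB⟩ := exists_injective_add_notMem (E := E) (A := A) (B := B)
    (by rwa [← coe_subset, hE]) (by omega) (by omega) (fun h ↦ hzero (hBE h))
    (by rw [hEn]; exact_mod_cast hp.trans_le (minSubgroupCard_le_minOrder G))
    (by rwa [hE]) hsingle
  have hbij : Function.Bijective
      (fun a ↦ ⟨f a, (hfB a).1⟩ : ↥(A : Set G) → ↥(B : Set G)) := by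
    refine (Fintype.bijective_iff_injective_and_card _).2 ⟨fun a b hab ↦ hf ?_, ?_⟩
    · exact congrArg Subtype.val hab
    · simp [hAn, hBn]
  refine ⟨Equiv.ofBijective _ hbij, fun a ↦ ?_⟩
  rw [← hE]
  exact (hfB a).2
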